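/- For integers $k,l\ge 2$, a function $f:\mathbb{N}\to\mathbb{N}$ is called $(k,l)$-synchronised if there is a finite automaton which reads, in parallel and most significant digit first, a base-$k$ representation of $n$ and a base-$l$ representation of $s$ (padded with leading zeros to equal length), and which accepts if and only if $f(n)=s$; $k$-synchronised means $(k,k)$-synchronised. Let $(d_n)_{n\ge 0}$ be the period-doubling sequence, given by $d_{2n}=1$, $d_{4n+1}=0$, $d_{4n+3}=d_n$ for $n \ge 0$, and let $\mathrm{sum}_{\mathrm{pd}}(n)=\sum_{i=0}^{n} d_i$ be its running sum. Let $S=\{(4^{r+1}-1)/3 : r\ge 0\}$, and define $g(n)=\max(\mathrm{sum}_{\mathrm{pd}}(n)-\lfloor 2n/3\rfloor,0)$ for $n\in S$ and $g(n)=0$ for $n\notin S$. Then: 1. $\mathrm{sum}_{\mathrm{pd}}$ is not $2$-synchronised. 2. For every integer $r\ge 0$, $\mathrm{sum}_{\mathrm{pd}}\big((4^{r+1}-1)/3\big)=(2\cdot 4^{r+1}+3r+1)/9$. 3. The set of base-$2$ representations of the elements of $S$ is a regular language. 4. $g$ is unbounded, $g(n)=O(\log n)$, and hence $g(n)=o(n)$.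 5. $g$ is not $2$-synchronised. -/

import Mathlib

/-- The natural number written in base `k` by the word `w`, most significant digit first.
Leading zeros are allowed, and the empty word represents `0`. -/
def msdValue (k : ℕ) (w : List (Fin k)) : ℕ :=
  Nat.ofDigits k (w.map Fin.val).reverse

/-- The words over pairs of digits whose first track is a base-`k` representation of some `n`,
and whose second track is a base-`l` representation of `f n`; the shorter of the two
representations is padded with leading zeros. -/
def graphLanguage (k l : ℕ) (f : ℕ → ℕ) : Language (Fin k × Fin l) :=
  {w | f (msdValue k (w.map Prod.fst)) = msdValue l (w.map Prod.snd)}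

/-- `f` is `(k, l)`-synchronised: a finite automaton, reading `n` in base `k` and `s` in base `l`
in parallel, accepts the pair `(n, s)` if and only if `f n = s`. -/
def IsSynchronised (k l : ℕ) (f : ℕ → ℕ) : Prop :=
  (graphLanguage k l f).IsRegular

/-- The words that represent in base `k` an element of `S`. -/
def setLanguage (k : ℕ) (S : Set ℕ) : Language (Fin k) :=
  {w | msdValue k w ∈ S}

/-- The base-`k` representations of the elements of `S` form a regular language. -/
def IsRegularSet (k : ℕ) (S : Set ℕ) : Prop :=
  (setLanguage k S).IsRegular

/-- The period-doubling sequence `d`, with `d (2n) = 1`, `d (4n+1) = 0`, `d (4n+3) = d n`. -/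
def periodDoubling (n : ℕ) : ℕ :=
  if n % 2 = 0 then 1 else if n % 4 = 1 then 0 else periodDoubling (n / 4)
termination_by n
decreasing_by omega

theorem periodDoubling_two_mul (n : ℕ) : periodDoubling (2 * n) = 1 := by
  rw [periodDoubling, if_pos (by omega)]

theorem periodDoubling_four_mul_add_one (n : ℕ) : periodDoubling (4 * n + 1) = 0 := by
  rw [periodDoubling, if_neg (by omega), if_pos (by omega)]

theorem periodDoubling_four_mul_add_three (n : ℕ) :
    periodDoubling (4 * n + 3) = periodDoubling n := by
  rw [periodDoubling, if_neg (by omega), if_neg (by omega)]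
  congr 1
  omega

/-- The running sum `a 0 + a 1 + ⋯ + a n`. -/
def runningSum (a : ℕ → ℕ) (n : ℕ) : ℕ :=
  ∑ i ∈ Finset.range (n + 1), a i

/-- The numbers `(4 ^ (r + 1) - 1) / 3`, `r ≥ 0` (the division is exact). -/
def repunitsFour : Set ℕ :=
  {n | ∃ r : ℕ, n = (4 ^ (r + 1) - 1) / 3}

/-- The running sum of the period-doubling sequence minus `⌊2n/3⌋` (truncated at `0`) on the
numbers `(4 ^ (r + 1) - 1) / 3`, and `0` elsewhere. -/
noncomputable def restrictedDifference : ℕ → ℕ :=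
  repunitsFour.indicator fun n => runningSum periodDoubling n - 2 * n / 3

/-! Each step `n ↦ 4 * n + 1` along `repunitsFour` raises the running sum by a third more than it
raises `2n/3`, so the excess is `(r + 1) / 3`: unbounded, yet logarithmic in `n`. At `r + 1 = 3k`
the excess is exactly `k`, while `n` and `⌊2n/3⌋` have binary words that repeat a 6-bit block `k`
times. An automaton accepting the graph would have to count these blocks. Finitely many states
confuse two counts, which `not_isSynchronised_of_repunitSixtyFour` turns into a contradiction for
both functions (`c = 14` and `c = 0`). -/

theorem runningSum_eq_sum_add (n : ℕ) :
    runningSum periodDoubling n = ∑ i ∈ Finset.range n, periodDoubling i + periodDoubling n :=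
  Finset.sum_range_succ _ _

/-- The block of indices `4n, …, 4n+3` contributes `1 + 0 + 1 + d n`. -/
theorem sum_range_four_mul_periodDoubling (n : ℕ) :
    ∑ i ∈ Finset.range (4 * n), periodDoubling i
      = 2 * n + ∑ i ∈ Finset.range n, periodDoubling i := by
  induction n with
  | zero => simp
  | succ n ih =>
    rw [show 4 * (n + 1) = 4 * n + 1 + 1 + 1 + 1 by ring]
    simp only [Finset.sum_range_succ, ih]
    rw [show 4 * n + 1 + 1 + 1 = 4 * n + 3 by ring, periodDoubling_four_mul_add_three,
      periodDoubling_four_mul_add_one, show 4 * n + 1 + 1 = 2 * (2 * n + 1) by ring,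
      periodDoubling_two_mul, show 4 * n = 2 * (2 * n) by ring, periodDoubling_two_mul]
    ring

theorem runningSum_periodDoubling_four_mul_add_one (n : ℕ) :
    runningSum periodDoubling (4 * n + 1) + periodDoubling n
      = 2 * n + 1 + runningSum periodDoubling n := by
  rw [runningSum_eq_sum_add, runningSum_eq_sum_add n, Finset.sum_range_succ,
    sum_range_four_mul_periodDoubling, periodDoubling_four_mul_add_one,
    show 4 * n = 2 * (2 * n) by ring, periodDoubling_two_mul]
  ring

/-- The number `(4 ^ (r + 1) - 1) / 3`. -/
def repunitFour (r : ℕ) : ℕ := (4 ^ (r + 1) - 1) / 3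

/-! ### Excess of the running sum on base-4 repunits -/

theorem repunitFour_zero : repunitFour 0 = 1 := rfl

theorem three_mul_repunitFour_add_one (r : ℕ) : 3 * repunitFour r + 1 = 4 ^ (r + 1) := by
  have h : 4 ^ (r + 1) % 3 = 1 := by rw [Nat.pow_mod]; simp
  unfold repunitFour
  generalize 4 ^ (r + 1) = N at h ⊢
  omega

theorem repunitFour_succ (r : ℕ) : repunitFour (r + 1) = 4 * repunitFour r + 1 := by
  have h := three_mul_repunitFour_add_one r
  have h' := three_mul_repunitFour_add_one (r + 1)
  rw [pow_succ] at h'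
  omega

theorem mem_repunitsFour_iff {n : ℕ} : n ∈ repunitsFour ↔ ∃ r, n = repunitFour r := Iff.rfl

theorem mem_repunitsFour_iff_eq_one_or {n : ℕ} :
    n ∈ repunitsFour ↔ n = 1 ∨ ∃ m ∈ repunitsFour, n = 4 * m + 1 := by
  simp only [mem_repunitsFour_iff]
  constructor
  · rintro ⟨_ | r, rfl⟩
    · exact Or.inl rfl
    · exact Or.inr ⟨_, ⟨r, rfl⟩, repunitFour_succ r⟩
  · rintro (rfl | ⟨_, ⟨r, rfl⟩, rfl⟩)
    · exact ⟨0, rfl⟩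
    · exact ⟨r + 1, (repunitFour_succ r).symm⟩

theorem periodDoubling_repunitFour (r : ℕ) : periodDoubling (repunitFour r) = 0 := by
  cases r with
  | zero => exact periodDoubling_four_mul_add_one 0
  | succ r => rw [repunitFour_succ, periodDoubling_four_mul_add_one]

/-- As `d` vanishes on these numbers, passing from `n` to `4n+1` adds `2n + 1` to the sum but only
`2n + 2/3` to `2n/3`. -/
theorem three_mul_runningSum_repunitFour (r : ℕ) :
    3 * runningSum periodDoubling (repunitFour r) = 2 * repunitFour r + r + 1 := by
  induction r with
  | zero =>
    have h := runningSum_periodDoubling_four_mul_add_one 0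
    have h0 := periodDoubling_two_mul 0
    simp only [runningSum, mul_zero, zero_add, Finset.sum_range_one] at h h0
    rw [repunitFour_zero, runningSum]
    omega
  | succ r ih =>
    have h := runningSum_periodDoubling_four_mul_add_one (repunitFour r)
    rw [periodDoubling_repunitFour] at h
    rw [repunitFour_succ]
    omega

theorem restrictedDifference_repunitFour (r : ℕ) :
    restrictedDifference (repunitFour r)
      = runningSum periodDoubling (repunitFour r) - 2 * repunitFour r / 3 :=
  Set.indicator_of_mem (mem_repunitsFour_iff.2 ⟨r, rfl⟩) _

theorem le_three_mul_restrictedDifference_repunitFour (r : ℕ) :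
    r + 1 ≤ 3 * restrictedDifference (repunitFour r) := by
  have h := three_mul_runningSum_repunitFour r
  rw [restrictedDifference_repunitFour]
  omega

theorem restrictedDifference_repunitFour_le (r : ℕ) :
    restrictedDifference (repunitFour r) ≤ r + 1 := by
  have h := three_mul_runningSum_repunitFour r
  rw [restrictedDifference_repunitFour]
  omega

theorem four_pow_le_repunitFour (r : ℕ) : 4 ^ r ≤ repunitFour r := by
  have h := three_mul_repunitFour_add_one r
  have h' := Nat.one_le_pow r 4 (by norm_num)
  rw [pow_succ] at h
  omega

/-- From `4 ^ r ≤ n` and `log 4 ≥ 1`, `r ≤ log n`. Excluding `n = 1` gives `r ≥ 1`, hence `r + 1 ≤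
2r`. -/
theorem restrictedDifference_le_log {n : ℕ} (hn : 2 ≤ n) :
    (restrictedDifference n : ℝ) ≤ 2 * Real.log n := by
  by_cases h : n ∈ repunitsFour
  · obtain ⟨r, rfl⟩ := mem_repunitsFour_iff.1 h
    have hr : 1 ≤ r := by
      rcases Nat.eq_zero_or_pos r with rfl | hr
      · simp [repunitFour_zero] at hn
      · exact hr
    have hle : (restrictedDifference (repunitFour r) : ℝ) ≤ r + 1 := by
      exact_mod_cast restrictedDifference_repunitFour_le r
    have hr' : (1 : ℝ) ≤ r := by exact_mod_cast hr
    have hlog : (r : ℝ) * Real.log 4 ≤ Real.log (repunitFour r) := by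
      rw [← Real.log_pow]
      exact Real.log_le_log (by positivity) (by exact_mod_cast four_pow_le_repunitFour r)
    have h4 : 1 ≤ Real.log 4 := by
      rw [Real.le_log_iff_exp_le (by norm_num)]
      linarith [Real.exp_one_lt_d9]
    nlinarith
  · rw [restrictedDifference, Set.indicator_of_notMem h]
    have := Real.log_natCast_nonneg n
    push_cast
    linarith

theorem restrictedDifference_isBigO_log :
    (fun n : ℕ => (restrictedDifference n : ℝ)) =O[Filter.atTop]
      (fun n : ℕ => Real.log n) := by
  refine Asymptotics.IsBigO.of_bound 2 ?_
  filter_upwards [Filter.eventually_ge_atTop 2] with n hn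
  rw [Real.norm_of_nonneg (Nat.cast_nonneg _), Real.norm_of_nonneg (Real.log_natCast_nonneg n)]
  exact restrictedDifference_le_log hn

/-! ### Binary words and non-synchronisation -/

theorem msdValue_append (k : ℕ) (u v : List (Fin k)) :
    msdValue k (u ++ v) = msdValue k u * k ^ v.length + msdValue k v := by
  simp only [msdValue, List.map_append, List.reverse_append, Nat.ofDigits_append,
    List.length_reverse, List.length_map]
  ring

theorem msdValue_singleton (k : ℕ) (b : Fin k) : msdValue k [b] = b := by
  simp [msdValue]

theorem exists_word_of_lt_pow {k l L a b : ℕ} (ha : a < k ^ L) (hb : b < l ^ L) :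
    ∃ w : List (Fin k × Fin l), w.length = L ∧
      msdValue k (w.map Prod.fst) = a ∧ msdValue l (w.map Prod.snd) = b := by
  induction L generalizing a b with
  | zero =>
    refine ⟨[], rfl, ?_, ?_⟩
    · simp only [pow_zero, Nat.lt_one_iff] at ha
      simp [msdValue, ha]
    · simp only [pow_zero, Nat.lt_one_iff] at hb
      simp [msdValue, hb]
  | succ L ih =>
    have hk : 0 < k := Nat.pos_of_ne_zero fun h => by simp [h] at ha
    have hl : 0 < l := Nat.pos_of_ne_zero fun h => by simp [h] at hb
    obtain ⟨w, hw, h₁, h₂⟩ := ih (a := a / k) (b := b / l)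
      (Nat.div_lt_of_lt_mul (by rwa [pow_succ'] at ha))
      (Nat.div_lt_of_lt_mul (by rwa [pow_succ'] at hb))
    refine ⟨w ++ [(⟨a % k, Nat.mod_lt _ hk⟩, ⟨b % l, Nat.mod_lt _ hl⟩)], by simp [hw], ?_, ?_⟩
    · rw [List.map_append, msdValue_append, h₁]
      simp [msdValue_singleton, Nat.div_add_mod']
    · rw [List.map_append, msdValue_append, h₂]
      simp [msdValue_singleton, Nat.div_add_mod']

/-- The sum `1 + 64 + ⋯ + 64 ^ (k - 1)`. -/
def repunitSixtyFour (k : ℕ) : ℕ := (64 ^ k - 1) / 63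

theorem repunitSixtyFour_spec (k : ℕ) : 63 * repunitSixtyFour k + 1 = 64 ^ k := by
  have h : 64 ^ k % 63 = 1 := by rw [Nat.pow_mod]; simp
  unfold repunitSixtyFour
  generalize 64 ^ k = N at h ⊢
  omega

theorem repunitSixtyFour_add (i m : ℕ) :
    repunitSixtyFour (i + m) = repunitSixtyFour i * 64 ^ m + repunitSixtyFour m := by
  have h := repunitSixtyFour_spec (i + m)
  rw [pow_add, ← repunitSixtyFour_spec i] at h
  have hm := repunitSixtyFour_spec m
  nlinarith

theorem le_repunitSixtyFour (k : ℕ) : k ≤ repunitSixtyFour k := by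
  induction k with
  | zero => simp
  | succ k ih =>
    have h := repunitSixtyFour_add k 1
    have h1 : repunitSixtyFour 1 = 1 := rfl
    omega

/-- A function whose graph contains `(21 A k, c A k + k)`, with `A k = (64 ^ k - 1) / 63`, is not
`2`-synchronised: the binary words of `21 A k` and `c A k` are periodic, so a finite automaton
cannot recover `k`. -/
theorem not_isSynchronised_of_repunitSixtyFour {f : ℕ → ℕ} {c : ℕ} (hc : c ≤ 60)
    (hf : ∀ k, 1 ≤ k → f (21 * repunitSixtyFour k) = c * repunitSixtyFour k + k) :
    ¬ IsSynchronised 2 2 f := by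
  rintro ⟨σ, _, M, hM⟩
  have hu (i : ℕ) : ∃ u : List (Fin 2 × Fin 2),
      msdValue 2 (u.map Prod.fst) = 21 * repunitSixtyFour i ∧
      msdValue 2 (u.map Prod.snd) = c * repunitSixtyFour i := by
    have h := repunitSixtyFour_spec i
    have hle : c * repunitSixtyFour i ≤ 60 * repunitSixtyFour i := Nat.mul_le_mul_right _ hc
    obtain ⟨u, -, h₁, h₂⟩ := exists_word_of_lt_pow (k := 2) (l := 2) (L := 6 * i)
      (a := 21 * repunitSixtyFour i) (b := c * repunitSixtyFour i)
      (by rw [pow_mul]; norm_num; omega) (by rw [pow_mul]; norm_num; omega)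
    exact ⟨u, h₁, h₂⟩
  choose u hu₁ hu₂ using hu
  obtain ⟨i, j, hij, hs⟩ := Finite.exists_ne_map_eq_of_infinite fun i => M.eval (u i)
  -- With `m > i`, the offset `i + m` is below `2m ≤ 2 A m`; since `c ≤ 60`, the second track still
  -- fits in `6m` bits.
  obtain ⟨m, hm⟩ : ∃ m, m = i + 1 := ⟨_, rfl⟩
  have hpow := repunitSixtyFour_spec m
  have hmle := le_repunitSixtyFour m
  have hle : c * repunitSixtyFour m ≤ 60 * repunitSixtyFour m := Nat.mul_le_mul_right _ hc
  obtain ⟨w, hw, hw₁, hw₂⟩ := exists_word_of_lt_pow (k := 2) (l := 2) (L := 6 * m)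
    (a := 21 * repunitSixtyFour m) (b := c * repunitSixtyFour m + (i + m))
    (by rw [pow_mul]; norm_num; omega) (by rw [pow_mul]; norm_num; omega)
  -- The suffix `w` fixes the offset `i + m`, whereas the prefix `u t` calls for `t + m`.
  have hmem (t : ℕ) : u t ++ w ∈ M.accepts ↔ t = i := by
    have h₁ : msdValue 2 ((u t ++ w).map Prod.fst) = 21 * repunitSixtyFour (t + m) := by
      rw [List.map_append, msdValue_append, hu₁, hw₁, List.length_map, hw, pow_mul,
        repunitSixtyFour_add]
      norm_num
      ring
    have h₂ : msdValue 2 ((u t ++ w).map Prod.snd)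
        = c * repunitSixtyFour (t + m) + (i + m) := by
      rw [List.map_append, msdValue_append, hu₂, hw₂, List.length_map, hw, pow_mul,
        repunitSixtyFour_add]
      norm_num
      ring
    rw [hM]
    change f (msdValue 2 ((u t ++ w).map Prod.fst)) = msdValue 2 ((u t ++ w).map Prod.snd) ↔ t = i
    rw [h₁, h₂, hf _ (by omega)]
    omega
  have hacc : u i ++ w ∈ M.accepts ↔ u j ++ w ∈ M.accepts := by
    simp only [DFA.mem_accepts, DFA.eval, DFA.evalFrom_of_append] at hs ⊢
    rw [hs]
  exact hij ((hmem j).1 (hacc.1 ((hmem i).2 rfl))).symm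

theorem repunitFour_eq_repunitSixtyFour {r k : ℕ} (h : r + 1 = 3 * k) :
    repunitFour r = 21 * repunitSixtyFour k := by
  have h₁ := three_mul_repunitFour_add_one r
  have h₂ := repunitSixtyFour_spec k
  rw [h, pow_mul] at h₁
  norm_num at h₁
  omega

theorem runningSum_repunitSixtyFour {k : ℕ} (hk : 1 ≤ k) :
    runningSum periodDoubling (21 * repunitSixtyFour k) = 14 * repunitSixtyFour k + k := by
  have hr : 3 * k - 1 + 1 = 3 * k := by omega
  have h := three_mul_runningSum_repunitFour (3 * k - 1)
  rw [repunitFour_eq_repunitSixtyFour hr] at h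
  omega

theorem restrictedDifference_repunitSixtyFour {k : ℕ} (hk : 1 ≤ k) :
    restrictedDifference (21 * repunitSixtyFour k) = k := by
  have hr : 3 * k - 1 + 1 = 3 * k := by omega
  have h := restrictedDifference_repunitFour (3 * k - 1)
  rw [repunitFour_eq_repunitSixtyFour hr, runningSum_repunitSixtyFour hk] at h
  omega

/-- The automaton for the binary representations of `repunitsFour`. The states stand for
the number `0`, the elements of `repunitsFour`, their doubles, and all other numbers. -/
def repunitsFourDFA : DFA (Fin 2) (Fin 4) where
  step s b := if b = 0 then ![0, 2, 3, 3] s else ![1, 3, 1, 3] s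
  start := 0
  accept := {1}

theorem repunitsFourDFA_eval (w : List (Fin 2)) :
    (repunitsFourDFA.eval w = 0 ↔ msdValue 2 w = 0) ∧
    (repunitsFourDFA.eval w = 1 ↔ msdValue 2 w ∈ repunitsFour) ∧
    (repunitsFourDFA.eval w = 2 ↔ ∃ m ∈ repunitsFour, msdValue 2 w = 2 * m) := by
  -- Oddness separates the elements from `0` and from their doubles.
  have hpos : ∀ m ∈ repunitsFour, m % 2 = 1 := fun m hm => by
    rcases mem_repunitsFour_iff_eq_one_or.1 hm with h | ⟨m', -, h⟩ <;> omega
  induction w using List.reverseRecOn with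
  | nil =>
    have h0 : msdValue 2 [] = 0 := rfl
    have he : repunitsFourDFA.eval [] = 0 := rfl
    rw [h0, he]
    refine ⟨by simp, ⟨by simp, fun h => ?_⟩, ⟨by simp, ?_⟩⟩
    · have := hpos _ h
      omega
    · rintro ⟨m, hm, h⟩
      have := hpos _ hm
      omega
  | append_singleton w b ih =>
    rw [msdValue_append, msdValue_singleton, DFA.eval_append_singleton]
    generalize msdValue 2 w = v at ih ⊢
    generalize repunitsFourDFA.eval w = s at ih ⊢
    obtain ⟨ih₀, ih₁, ih₂⟩ := ih
    simp only [List.length_singleton, pow_one]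
    fin_cases b
    · have e₁ : ¬ (v * 2 ∈ repunitsFour) := fun h => by
        have := hpos _ h
        omega
      have e₂ : (∃ m ∈ repunitsFour, v * 2 = 2 * m) ↔ v ∈ repunitsFour :=
        ⟨fun ⟨m, hm, h⟩ => by rwa [show v = m by omega], fun h => ⟨v, h, by ring⟩⟩
      have e₀ : v * 2 = 0 ↔ v = 0 := by omega
      simp only [Fin.zero_eta, add_zero, e₁, e₂, e₀, ← ih₀, ← ih₁]
      fin_cases s <;> simp [repunitsFourDFA]
    · have e₁ : v * 2 + 1 ∈ repunitsFour ↔ v = 0 ∨ ∃ m ∈ repunitsFour, v = 2 * m := by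
        rw [mem_repunitsFour_iff_eq_one_or]
        refine or_congr (by omega) (exists_congr fun m => and_congr_right fun _ => by omega)
      have e₂ : ¬ ∃ m ∈ repunitsFour, v * 2 + 1 = 2 * m := fun ⟨m, _, h⟩ => by omega
      simp only [Fin.mk_one, e₁, e₂, ← ih₀, ← ih₂]
      fin_cases s <;> simp [repunitsFourDFA]

theorem isRegularSet_repunitsFour : IsRegularSet 2 repunitsFour :=
  ⟨Fin 4, inferInstance, repunitsFourDFA, Set.ext fun w => (repunitsFourDFA_eval w).2.1⟩

theorem mainTheorem2 :
    ¬ IsSynchronised 2 2 (runningSum periodDoubling) ∧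
    (∀ r : ℕ, (runningSum periodDoubling ((4 ^ (r + 1) - 1) / 3) : ℚ)
      = (2 * 4 ^ (r + 1) + 3 * r + 1) / 9) ∧
    IsRegularSet 2 repunitsFour ∧
    (¬ ∃ B : ℕ, ∀ n : ℕ, restrictedDifference n ≤ B) ∧
    (fun n : ℕ => (restrictedDifference n : ℝ)) =O[Filter.atTop] (fun n : ℕ => Real.log n) ∧
    (fun n : ℕ => (restrictedDifference n : ℝ)) =o[Filter.atTop] (fun n : ℕ => (n : ℝ)) ∧
    ¬ IsSynchronised 2 2 restrictedDifference := by
  refine ⟨not_isSynchronised_of_repunitSixtyFour (c := 14) (by norm_num)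
      fun k => runningSum_repunitSixtyFour, fun r => ?_, isRegularSet_repunitsFour, ?_,
    restrictedDifference_isBigO_log, ?_,
    not_isSynchronised_of_repunitSixtyFour (c := 0) (by norm_num) fun k hk => by
      rw [restrictedDifference_repunitSixtyFour hk, zero_mul, zero_add]⟩
  · have h₁ : (3 * runningSum periodDoubling (repunitFour r) : ℚ) = 2 * repunitFour r + r + 1 := by
      exact_mod_cast three_mul_runningSum_repunitFour r
    have h₂ : (3 * repunitFour r + 1 : ℚ) = 4 ^ (r + 1) := by
      exact_mod_cast three_mul_repunitFour_add_one r
    change (runningSum periodDoubling (repunitFour r) : ℚ) = _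
    linarith
  · rintro ⟨B, hB⟩
    -- The excess is about `r / 3`, so `r = 3B` already exceeds `B`.
    have h₁ := le_three_mul_restrictedDifference_repunitFour (3 * B)
    have h₂ := hB (repunitFour (3 * B))
    omega
  · exact restrictedDifference_isBigO_log.trans_isLittleO
      (Real.isLittleO_log_id_atTop.comp_tendsto tendsto_natCast_atTop_atTop)
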